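/- Let $\lambda,\mu\in\mathbb R$ satisfy $\mu>0$ and $\lambda+\mu\ge 0$. In dimension $d=1$ the Lamé operator is $\Delta^\ast u=\mu u''+(\lambda+\mu)u''=(\lambda+2\mu)u''$. Let $H^2(\mathbb R)$ denote the usual Sobolev space of functions $u\in L^2(\mathbb R;\mathbb C)$ whose weak derivatives $u',u''$ belong to $L^2$, and let $\dot H^1(\mathbb R)$ denote the space of locally integrable functions $u:\mathbb R\to\mathbb C$ (modulo equality almost everywhere) with weak derivative $u'\in L^2(\mathbb R;\mathbb C)$. For a measurable damping $a:\mathbb R\to\mathbb C$, let $A_a^\ast$ be the damped elastic wave operator $$A_a^\ast\begin{pmatrix}\psi_1\\ \psi_2\end{pmatrix}=\begin{pmatrix}0&1\\ \Delta^\ast&-a\end{pmatrix}\begin{pmatrix}\psi_1\\ \psi_2\end{pmatrix}=\begin{pmatrix}\psi_2\\ \Delta^\ast\psi_1-a\psi_2\end{pmatrix},\qquad \mathcal D(A_a^\ast)=H^2(\mathbb R)\times\dot H^1(\mathbb R),$$ and let $\sigma_{\mathrm p}(A_a^\ast)$ be the set of its eigenvalues, that is, of all $z\in\mathbb C$ such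 that $A_a^\ast\Psi=z\Psi$ (almost everywhere) for some $\Psi\in\mathcal D(A_a^\ast)$, $\Psi\neq 0$. (i) If $a\in L^1(\mathbb R;\mathbb C)$ and $\|a\|_{L^1(\mathbb R)}<2\sqrt{\lambda+2\mu}$, then $\sigma_{\mathrm p}(A_a^\ast)=\varnothing$. (ii) The constant $2\sqrt{\lambda+2\mu}$ is optimal: for every real $C>2\sqrt{\lambda+2\mu}$ there is a damping $a\in L^1(\mathbb R;\mathbb C)\cap L^\infty(\mathbb R;\mathbb C)$ with $\|a\|_{L^1(\mathbb R)}<C$ and $\sigma_{\mathrm p}(A_a^\ast)\neq\varnothing$. -/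

import Mathlib

open MeasureTheory
open scoped ContDiff

/-- Classes, modulo equality almost everywhere, of measurable functions `ℝ → ℂ`. All the function
spaces below are subspaces of this vector space. -/
abbrev MeasFun : Type := ℝ →ₘ[(volume : Measure ℝ)] ℂ

/-- `v` is the weak derivative of `u`: both are locally integrable and `∫ φ' u = - ∫ φ v` for all
(real-valued) test functions `φ ∈ C_c^∞(ℝ)`. -/
def IsWeakDeriv (u v : MeasFun) : Prop :=
  LocallyIntegrable u volume ∧ LocallyIntegrable v volume ∧
    ∀ φ : ℝ → ℝ, ContDiff ℝ ∞ φ → HasCompactSupport φ →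
      ∫ x, deriv φ x • u x = - ∫ x, φ x • v x

theorem locallyIntegrable_add_measFun {u v : MeasFun} (hu : LocallyIntegrable u volume)
    (hv : LocallyIntegrable v volume) : LocallyIntegrable (u + v : MeasFun) volume :=
  (hu.add hv).congr (AEEqFun.coeFn_add u v).symm

theorem locallyIntegrable_smul_measFun {u : MeasFun} (c : ℂ) (hu : LocallyIntegrable u volume) :
    LocallyIntegrable (c • u : MeasFun) volume :=
  (hu.smul c).congr (AEEqFun.coeFn_smul c u).symm

theorem integrable_testFun_smul {u : MeasFun} (hu : LocallyIntegrable u volume) {φ : ℝ → ℝ}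
    (hφ : Continuous φ) (hc : HasCompactSupport φ) :
    Integrable (fun x => φ x • u x) volume :=
  hu.integrable_smul_left_of_hasCompactSupport hφ hc

theorem IsWeakDeriv.unique {u v w : MeasFun} (hv : IsWeakDeriv u v) (hw : IsWeakDeriv u w) :
    v = w := by
  refine AEEqFun.ext ?_
  refine ae_eq_of_integral_contDiff_smul_eq hv.2.1 hw.2.1 fun φ hφ hc => ?_
  have h := (hv.2.2 φ hφ hc).symm.trans (hw.2.2 φ hφ hc)
  exact neg_injective h

theorem IsWeakDeriv.add {u u' v v' : MeasFun} (h : IsWeakDeriv u v) (h' : IsWeakDeriv u' v') :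
    IsWeakDeriv (u + u') (v + v') := by
  refine ⟨locallyIntegrable_add_measFun h.1 h'.1, locallyIntegrable_add_measFun h.2.1 h'.2.1,
    fun φ hφ hc => ?_⟩
  have hd : Continuous (deriv φ) := hφ.continuous_deriv (by simp)
  have e1 : ∫ x, deriv φ x • (u + u' : MeasFun) x
      = ∫ x, (deriv φ x • u x + deriv φ x • u' x) := by
    refine integral_congr_ae ?_
    filter_upwards [AEEqFun.coeFn_add u u'] with x hx
    simp only [hx, Pi.add_apply, smul_add]
  have e2 : ∫ x, φ x • (v + v' : MeasFun) x = ∫ x, (φ x • v x + φ x • v' x) := by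
    refine integral_congr_ae ?_
    filter_upwards [AEEqFun.coeFn_add v v'] with x hx
    simp only [hx, Pi.add_apply, smul_add]
  rw [e1, e2, integral_add (integrable_testFun_smul h.1 hd hc.deriv)
      (integrable_testFun_smul h'.1 hd hc.deriv),
    integral_add (integrable_testFun_smul h.2.1 hφ.continuous hc)
      (integrable_testFun_smul h'.2.1 hφ.continuous hc), h.2.2 φ hφ hc, h'.2.2 φ hφ hc, neg_add]

theorem IsWeakDeriv.smul {u v : MeasFun} (c : ℂ) (h : IsWeakDeriv u v) :
    IsWeakDeriv (c • u) (c • v) := by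
  refine ⟨locallyIntegrable_smul_measFun c h.1, locallyIntegrable_smul_measFun c h.2.1,
    fun φ hφ hc => ?_⟩
  have e1 : ∫ x, deriv φ x • (c • u : MeasFun) x = ∫ x, c • (deriv φ x • u x) := by
    refine integral_congr_ae ?_
    filter_upwards [AEEqFun.coeFn_smul c u] with x hx
    simp only [hx, Pi.smul_apply, smul_comm c]
  have e2 : ∫ x, φ x • (c • v : MeasFun) x = ∫ x, c • (φ x • v x) := by
    refine integral_congr_ae ?_
    filter_upwards [AEEqFun.coeFn_smul c v] with x hx
    simp only [hx, Pi.smul_apply, smul_comm c]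
  rw [e1, e2, integral_smul, integral_smul, h.2.2 φ hφ hc, smul_neg]

theorem isWeakDeriv_zero : IsWeakDeriv 0 0 := by
  have h0 : LocallyIntegrable (0 : MeasFun) volume :=
    (locallyIntegrable_zero (X := ℝ) (ε'' := ℂ)).congr (AEEqFun.coeFn_zero).symm
  refine ⟨h0, h0, fun φ _ _ => ?_⟩
  have e (ψ : ℝ → ℝ) : ∫ x, ψ x • (0 : MeasFun) x = 0 := by
    refine integral_eq_zero_of_ae ?_
    filter_upwards [AEEqFun.coeFn_zero (α := ℝ) (β := ℂ) (μ := volume)] with x hx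
    simp [hx]
  rw [e, e, neg_zero]

open Classical in
/-- The weak derivative `u'` of `u`; it is only used where it exists (elsewhere the value is `0`). -/
noncomputable def weakDeriv (u : MeasFun) : MeasFun :=
  if h : ∃ v, IsWeakDeriv u v then h.choose else 0

theorem IsWeakDeriv.weakDeriv_eq {u v : MeasFun} (h : IsWeakDeriv u v) : weakDeriv u = v := by
  have hex : ∃ v, IsWeakDeriv u v := ⟨v, h⟩
  rw [weakDeriv, dif_pos hex]
  exact hex.choose_spec.unique h

theorem memLp_add_measFun {u v : MeasFun} (hu : MemLp u 2 volume) (hv : MemLp v 2 volume) :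
    MemLp (u + v : MeasFun) 2 volume :=
  (hu.add hv).ae_eq (AEEqFun.coeFn_add u v).symm

theorem memLp_smul_measFun {u : MeasFun} (c : ℂ) (hu : MemLp u 2 volume) :
    MemLp (c • u : MeasFun) 2 volume :=
  (hu.const_smul c).ae_eq (AEEqFun.coeFn_smul c u).symm

theorem memLp_zero_measFun : MemLp (0 : MeasFun) 2 volume :=
  (MemLp.zero (ε := ℂ)).ae_eq (AEEqFun.coeFn_zero).symm

/-- The homogeneous Sobolev space `Ḣ¹(ℝ)`: the locally integrable functions whose weak derivative
exists and is square integrable. -/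
def homSobolevH1 : Submodule ℂ MeasFun where
  carrier := {u | ∃ v, IsWeakDeriv u v ∧ MemLp v 2 volume}
  add_mem' := by
    rintro u u' ⟨v, h, hv⟩ ⟨v', h', hv'⟩
    exact ⟨v + v', h.add h', memLp_add_measFun hv hv'⟩
  zero_mem' := ⟨0, isWeakDeriv_zero, memLp_zero_measFun⟩
  smul_mem' := by
    rintro c u ⟨v, h, hv⟩
    exact ⟨c • v, h.smul c, memLp_smul_measFun c hv⟩

/-- The Sobolev space `H²(ℝ)`: the square integrable functions whose first and second weak
derivatives exist and are square integrable. -/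
def sobolevH2 : Submodule ℂ MeasFun where
  carrier := {u | MemLp u 2 volume ∧ ∃ v w, IsWeakDeriv u v ∧ IsWeakDeriv v w ∧
    MemLp v 2 volume ∧ MemLp w 2 volume}
  add_mem' := by
    rintro u u' ⟨hu, v, w, h1, h2, hv, hw⟩ ⟨hu', v', w', h1', h2', hv', hw'⟩
    exact ⟨memLp_add_measFun hu hu', v + v', w + w', h1.add h1', h2.add h2',
      memLp_add_measFun hv hv', memLp_add_measFun hw hw'⟩
  zero_mem' := ⟨memLp_zero_measFun, 0, 0, isWeakDeriv_zero, isWeakDeriv_zero,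
    memLp_zero_measFun, memLp_zero_measFun⟩
  smul_mem' := by
    rintro c u ⟨hu, v, w, h1, h2, hv, hw⟩
    exact ⟨memLp_smul_measFun c hu, c • v, c • w, h1.smul c, h2.smul c,
      memLp_smul_measFun c hv, memLp_smul_measFun c hw⟩

/-- The Lamé operator `Δ* u = μ Δ u + (lam + μ) ∇ div u` in dimension one, where both `Δ u` and
`∇ div u` are the second derivative `u''`. -/
noncomputable def lameOp (lam μ : ℝ) (u : MeasFun) : MeasFun :=
  (μ : ℂ) • weakDeriv (weakDeriv u) + ((lam + μ : ℝ) : ℂ) • weakDeriv (weakDeriv u)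

theorem lameOp_add (lam μ : ℝ) {u u' : MeasFun} (hu : u ∈ sobolevH2) (hu' : u' ∈ sobolevH2) :
    lameOp lam μ (u + u') = lameOp lam μ u + lameOp lam μ u' := by
  obtain ⟨-, v, w, h1, h2, -⟩ := hu
  obtain ⟨-, v', w', h1', h2', -⟩ := hu'
  simp only [lameOp, (h1.add h1').weakDeriv_eq, (h2.add h2').weakDeriv_eq, h1.weakDeriv_eq,
    h2.weakDeriv_eq, h1'.weakDeriv_eq, h2'.weakDeriv_eq, smul_add]
  abel

theorem lameOp_smul (lam μ : ℝ) (c : ℂ) {u : MeasFun} (hu : u ∈ sobolevH2) :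
    lameOp lam μ (c • u) = c • lameOp lam μ u := by
  obtain ⟨-, v, w, h1, h2, -⟩ := hu
  simp only [lameOp, (h1.smul c).weakDeriv_eq, (h2.smul c).weakDeriv_eq, h1.weakDeriv_eq,
    h2.weakDeriv_eq, smul_add, smul_comm c]

theorem mul_add_measFun (a v v' : MeasFun) : a * (v + v') = a * v + a * v' := by
  refine AEEqFun.ext ?_
  filter_upwards [AEEqFun.coeFn_mul a (v + v'), AEEqFun.coeFn_add v v',
    AEEqFun.coeFn_add (a * v) (a * v'), AEEqFun.coeFn_mul a v, AEEqFun.coeFn_mul a v']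
    with x h1 h2 h3 h4 h5
  simp only [h1, h2, h3, h4, h5, Pi.add_apply, Pi.mul_apply, mul_add]

theorem mul_smul_measFun (a : MeasFun) (c : ℂ) (v : MeasFun) : a * (c • v) = c • (a * v) := by
  refine AEEqFun.ext ?_
  filter_upwards [AEEqFun.coeFn_mul a (c • v), AEEqFun.coeFn_smul c v,
    AEEqFun.coeFn_smul c (a * v), AEEqFun.coeFn_mul a v] with x h1 h2 h3 h4
  simp only [h1, h2, h3, h4, Pi.smul_apply, Pi.mul_apply, mul_smul_comm]

/-- The damped elastic wave operator in dimension one, with the matrix `(0, 1; Δ*, -a)` and the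
domain `H²(ℝ) × Ḣ¹(ℝ)`, i.e. `(ψ₁, ψ₂) ↦ (ψ₂, Δ* ψ₁ - a ψ₂)`, as an unbounded linear operator. -/
noncomputable def dampedElasticWaveOp (lam μ : ℝ) (a : MeasFun) :
    (MeasFun × MeasFun) →ₗ.[ℂ] (MeasFun × MeasFun) where
  domain := sobolevH2.prod homSobolevH1
  toFun :=
    { toFun := fun Ψ => (Ψ.1.2, lameOp lam μ Ψ.1.1 - a * Ψ.1.2)
      map_add' := by
        rintro ⟨⟨u, v⟩, hu, hv⟩ ⟨⟨u', v'⟩, hu', hv'⟩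
        refine Prod.ext rfl ?_
        change lameOp lam μ (u + u') - a * (v + v')
          = (lameOp lam μ u - a * v) + (lameOp lam μ u' - a * v')
        rw [lameOp_add lam μ hu hu', mul_add_measFun]
        abel
      map_smul' := by
        rintro c ⟨⟨u, v⟩, hu, hv⟩
        refine Prod.ext rfl ?_
        change lameOp lam μ (c • u) - a * (c • v) = c • (lameOp lam μ u - a * v)
        rw [lameOp_smul lam μ c hu, smul_sub, mul_smul_measFun] }

/-- The point spectrum (set of eigenvalues) of an unbounded linear operator. -/
def pointSpectrum {E : Type*} [AddCommGroup E] [Module ℂ E] (A : E →ₗ.[ℂ] E) : Set ℂ :=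
  {z | ∃ Ψ : A.domain, Ψ ≠ 0 ∧ A Ψ = z • (Ψ : E)}

/-! An eigenvector for `z` has second component `z u`, and with `c = √(lam + 2 μ)` its first
component solves `u'' = κ² u + b u`, where `κ = ± z / c` and `b = z a / c²`. The sign is chosen so
that `0 ≤ Re κ`; the imaginary axis needs no separate treatment.

The equation factors as `(D + κ)(D - κ) u = b u`, so `(e^{κx} (u' - κ u))' = e^{κx} b u`. Since `u'
- κ u` is in `L²` and `e^{κx}` is bounded near `-∞`, the boundary term there vanishes, and `|u' - κ
u|(x) ≤ sup |u| · ∫_{-∞}^x |b|` (`norm_deriv_sub_mul_le`). Reflection gives `|u' + κ u|(x) ≤ sup |u|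
· ∫_x^∞ |b|`. Subtracting, `2 |κ| sup |u| ≤ ‖b‖₁ sup |u|`, which forces `u = 0` when `‖b‖₁ < 2 |κ|`,
that is, when `‖a‖₁ < 2 c` and `z ≠ 0` (`eq_zero_of_schrodinger_equation`).

For optimality, `u = cosh^{-s}` satisfies `u'' = (s² - s (s + 1) sech²) u`. This is the eigenvalue
equation for `z = c s` and `a = -c (s + 1) sech²`, and `‖a‖₁ = 2 c (1 + s)` tends to `2 c` as `s →
0`. -/

/-! ### Primitives of locally integrable functions. -/

/-- `U` is a primitive of the locally integrable function `f`: a locally absolutely continuous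
function with derivative `f` almost everywhere. -/
structure IsPrimitive (U f : ℝ → ℂ) : Prop where
  locallyIntegrable : LocallyIntegrable f volume
  sub_eq : ∀ a b : ℝ, U b - U a = ∫ t in a..b, f t

theorem MeasureTheory.LocallyIntegrable.intervalIntegrable_real {f : ℝ → ℂ}
    (hf : LocallyIntegrable f volume) (a b : ℝ) : IntervalIntegrable f volume a b :=
  intervalIntegrable_iff.mpr
    ((hf.integrableOn_isCompact isCompact_uIcc).mono_set Set.uIoc_subset_uIcc)

theorem isPrimitive_intervalIntegral {f : ℝ → ℂ} (hf : LocallyIntegrable f volume) (c : ℂ) :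
    IsPrimitive (fun x => c + ∫ t in (0 : ℝ)..x, f t) f where
  locallyIntegrable := hf
  sub_eq a b := by
    rw [add_sub_add_left_eq_sub, intervalIntegral.integral_interval_sub_left] <;>
      exact hf.intervalIntegrable_real _ _

/-- The real-valued result is applied to the real and imaginary parts, which are then recombined as
multiples of `1` and `I`. -/
theorem absolutelyContinuousOnInterval_intervalIntegral_complex {f : ℝ → ℂ}
    (hf : LocallyIntegrable f volume) (a b : ℝ) :
    AbsolutelyContinuousOnInterval (fun x => ∫ t in a..x, f t) a b := by
  have hi := hf.intervalIntegrable_real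
  have hre : ∀ x y, IntervalIntegrable (fun t => (f t).re) volume x y := fun x y =>
    ⟨(hi x y).1.re, (hi x y).2.re⟩
  have him : ∀ x y, IntervalIntegrable (fun t => (f t).im) volume x y := fun x y =>
    ⟨(hi x y).1.im, (hi x y).2.im⟩
  have hc : ∀ z : ℂ, AbsolutelyContinuousOnInterval (fun _ : ℝ => z) a b := fun z =>
    contDiffOn_const.absolutelyContinuousOnInterval
  have key := (((hre a b).absolutelyContinuousOnInterval_intervalIntegral
      Set.left_mem_uIcc).smul (hc 1)).add
    (((him a b).absolutelyContinuousOnInterval_intervalIntegral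
      Set.left_mem_uIcc).smul (hc Complex.I))
  refine (congrArg (AbsolutelyContinuousOnInterval · a b) (funext fun x => ?_)).mpr key
  simp only [Pi.add_apply, Pi.smul_apply', Complex.real_smul, mul_one]
  rw [← intervalIntegral.integral_ofReal, ← intervalIntegral.integral_ofReal,
    ← intervalIntegral.integral_mul_const, ← intervalIntegral.integral_add]
  · simp only [Complex.re_add_im]
  · exact ⟨(hre a x).1.ofReal, (hre a x).2.ofReal⟩
  · exact ⟨(him a x).1.ofReal.mul_const _, (him a x).2.ofReal.mul_const _⟩

namespace IsPrimitive

variable {U f : ℝ → ℂ}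

theorem absolutelyContinuousOnInterval (h : IsPrimitive U f) (a b : ℝ) :
    AbsolutelyContinuousOnInterval U a b := by
  have hc : AbsolutelyContinuousOnInterval (fun _ : ℝ => U a) a b :=
    contDiffOn_const.absolutelyContinuousOnInterval
  refine (congrArg (AbsolutelyContinuousOnInterval · a b) (funext fun x => ?_)).mpr
    (hc.add (absolutelyContinuousOnInterval_intervalIntegral_complex h.locallyIntegrable a b))
  simp only [Pi.add_apply, ← h.sub_eq a x, add_sub_cancel]

theorem ae_hasDerivAt (h : IsPrimitive U f) : ∀ᵐ x, HasDerivAt U (f x) x := by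
  filter_upwards [LocallyIntegrable.ae_hasDerivAt_integral h.locallyIntegrable] with x hx
  have : U = fun x => U 0 + ∫ t in (0 : ℝ)..x, f t := by
    funext y
    rw [← h.sub_eq 0 y, add_sub_cancel]
  rw [this]
  exact (hx 0).const_add _

theorem continuous (h : IsPrimitive U f) : Continuous U := by
  have : U = fun x => U 0 + ∫ t in (0 : ℝ)..x, f t := by
    funext y
    rw [← h.sub_eq 0 y, add_sub_cancel]
  rw [this]
  exact continuous_const.add
    (intervalIntegral.continuous_primitive h.locallyIntegrable.intervalIntegrable_real 0)

theorem of_hasDerivAt (hd : ∀ x, HasDerivAt U (f x) x) (hf : Continuous f) : IsPrimitive U f where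
  locallyIntegrable := hf.locallyIntegrable
  sub_eq a b := (intervalIntegral.integral_eq_sub_of_hasDerivAt (fun x _ => hd x)
    (hf.intervalIntegrable a b)).symm

theorem hasDerivAt (h : IsPrimitive U f) (hf : Continuous f) (x : ℝ) : HasDerivAt U (f x) x := by
  have : U = fun x => U 0 + ∫ t in (0 : ℝ)..x, f t := by
    funext y
    rw [← h.sub_eq 0 y, add_sub_cancel]
  rw [this]
  exact (intervalIntegral.integral_hasDerivAt_right (hf.intervalIntegrable 0 x)
    hf.stronglyMeasurable.stronglyMeasurableAtFilter hf.continuousAt).const_add _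

/-- The product rule for a continuously differentiable and an absolutely continuous function. -/
theorem mul {E E' : ℝ → ℂ} (h : IsPrimitive U f) (hE : ∀ x, HasDerivAt E (E' x) x)
    (hE' : Continuous E') : IsPrimitive (fun x => E x * U x) (fun x => E' x * U x + E x * f x) := by
  have hEc : Continuous E := continuous_iff_continuousAt.2 fun x => (hE x).continuousAt
  have hloc : LocallyIntegrable (fun x => E' x * U x + E x * f x) volume := by
    refine (hE'.mul h.continuous).locallyIntegrable.add ?_
    have := h.locallyIntegrable
    rw [← locallyIntegrableOn_univ] at this ⊢
    exact this.continuousOn_mul hEc.continuousOn isOpen_univ.isLocallyClosed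
  refine ⟨hloc, fun a b => ?_⟩
  have hEC : ContDiff ℝ 1 E := by
    rw [contDiff_one_iff_deriv]
    refine ⟨fun x => (hE x).differentiableAt, ?_⟩
    rwa [show deriv E = E' from funext fun x => (hE x).deriv]
  -- `E U` minus the integral of the claimed derivative is absolutely continuous with derivative
  -- zero almost everywhere, hence constant.
  have hG := (hEC.contDiffOn.absolutelyContinuousOnInterval.smul
    (h.absolutelyContinuousOnInterval a b)).sub
      (absolutelyContinuousOnInterval_intervalIntegral_complex hloc a b)
  obtain ⟨C, hC⟩ := hG.const_of_ae_hasDerivAt_zero (by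
    filter_upwards [h.ae_hasDerivAt, LocallyIntegrable.ae_hasDerivAt_integral hloc] with x h1 h2 _
    have := ((hE x).mul h1).sub (h2 a)
    rw [sub_self] at this
    exact this)
  have h1 := hC a Set.left_mem_uIcc
  have h2 := hC b Set.right_mem_uIcc
  simp only [Pi.sub_apply, Pi.mul_apply, smul_eq_mul, intervalIntegral.integral_same,
    sub_zero] at h1 h2
  rw [h1, ← h2]
  ring

theorem add {V g : ℝ → ℂ} (h : IsPrimitive U f) (h' : IsPrimitive V g) :
    IsPrimitive (fun x => U x + V x) (fun x => f x + g x) where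
  locallyIntegrable := h.locallyIntegrable.add h'.locallyIntegrable
  sub_eq a b := by
    rw [intervalIntegral.integral_add (h.locallyIntegrable.intervalIntegrable_real a b)
      (h'.locallyIntegrable.intervalIntegrable_real a b), ← h.sub_eq, ← h'.sub_eq]
    ring

theorem const_mul (h : IsPrimitive U f) (c : ℂ) :
    IsPrimitive (fun x => c * U x) (fun x => c * f x) where
  locallyIntegrable := h.locallyIntegrable.smul c
  sub_eq a b := by
    rw [intervalIntegral.integral_const_mul, ← h.sub_eq]
    ring

/-- Reflection carries the estimate from `-∞` over to `+∞`. -/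
theorem comp_neg (h : IsPrimitive U f) :
    IsPrimitive (fun x => U (-x)) (fun x => -f (-x)) where
  locallyIntegrable := by
    refine LocallyIntegrable.neg ?_
    refine (MeasureTheory.locallyIntegrable_iff).2 fun K hK => ?_
    have := (h.locallyIntegrable.integrableOn_isCompact hK.neg)
    rw [← (Measure.measurePreserving_neg (volume : Measure ℝ)).integrableOn_comp_preimage
      (Homeomorph.neg ℝ).measurableEmbedding] at this
    simpa [Function.comp_def] using this
  sub_eq a b := by
    rw [intervalIntegral.integral_neg, intervalIntegral.integral_comp_neg, ← h.sub_eq]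
    ring

theorem congr_ae {g : ℝ → ℂ} (h : IsPrimitive U f) (hfg : f =ᵐ[volume] g) : IsPrimitive U g where
  locallyIntegrable := h.locallyIntegrable.congr hfg
  sub_eq a b := by
    rw [h.sub_eq a b]
    exact intervalIntegral.integral_congr_ae (hfg.mono fun x hx _ => hx)

/-- Integration by parts against a test function. -/
theorem integral_deriv_smul (h : IsPrimitive U f) {φ : ℝ → ℝ} (hφ : ContDiff ℝ ∞ φ)
    (hc : HasCompactSupport φ) : ∫ x, deriv φ x • U x = - ∫ x, φ x • f x := by
  have hd : Continuous (deriv φ) := hφ.continuous_deriv (by simp)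
  have hm := h.mul (E := fun x => (φ x : ℂ)) (E' := fun x => ((deriv φ x : ℝ) : ℂ))
    (fun x => ((hφ.differentiable (by simp)).differentiableAt.hasDerivAt).ofReal_comp)
    (Complex.continuous_ofReal.comp hd)
  have i1 : Integrable (fun x => deriv φ x • U x) volume :=
    h.continuous.locallyIntegrable.integrable_smul_left_of_hasCompactSupport hd hc.deriv
  have i2 : Integrable (fun x => φ x • f x) volume :=
    h.locallyIntegrable.integrable_smul_left_of_hasCompactSupport hφ.continuous hc
  rw [eq_neg_iff_add_eq_zero, ← integral_add i1 i2]
  have ht := intervalIntegral_tendsto_integral (i1.add i2) Filter.tendsto_neg_atTop_atBot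
    Filter.tendsto_id
  obtain ⟨R, hR⟩ := hc.isCompact.isBounded.subset_closedBall 0
  -- Once `[-x, x]` contains the support of `φ` in its interior, `φ U` vanishes at both endpoints
  -- and the integral of its derivative is exactly zero.
  refine tendsto_nhds_unique ht (tendsto_const_nhds.congr' ?_)
  filter_upwards [Filter.eventually_gt_atTop (max R 0)] with x hx
  have hx1 := (max_lt_iff.1 hx).1
  have hx0 := (max_lt_iff.1 hx).2
  have z : ∀ y : ℝ, |y| = x → φ y = 0 := fun y hy => by
    by_contra hne
    have := hR (subset_tsupport φ hne)
    rw [mem_closedBall_zero_iff, Real.norm_eq_abs, hy] at this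
    linarith
  have := hm.sub_eq (-x) x
  rw [z x (abs_of_pos hx0), z (-x) (by rw [abs_neg, abs_of_pos hx0])] at this
  simpa [Complex.real_smul] using this

end IsPrimitive

/-! ### Weak derivatives and absolutely continuous representatives. -/

/-- The du Bois-Reymond lemma: a locally integrable function with vanishing weak derivative is
constant almost everywhere. -/
theorem ae_eq_const_of_integral_deriv_smul_eq_zero {u : ℝ → ℂ} (hu : LocallyIntegrable u volume)
    (h : ∀ φ : ℝ → ℝ, ContDiff ℝ ∞ φ → HasCompactSupport φ → ∫ x, deriv φ x • u x = 0) :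
    ∃ c : ℂ, u =ᵐ[volume] fun _ => c := by
  let ψ : ContDiffBump (0 : ℝ) := ⟨1, 2, one_pos, one_lt_two⟩
  let ρ : ℝ → ℝ := ψ.normed volume
  have hρ : ContDiff ℝ ∞ ρ := ψ.contDiff_normed
  have hρc : HasCompactSupport ρ := ψ.hasCompactSupport_normed
  have hρ1 : ∫ x, ρ x = 1 := ψ.integral_normed
  refine ⟨∫ x, ρ x • u x, ?_⟩
  refine ae_eq_of_integral_contDiff_smul_eq hu (locallyIntegrable_const _) fun φ hφ hc => ?_
  set m : ℝ := ∫ x, φ x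
  -- Removing the mean of `φ` with the unit-mass bump `ρ` leaves a function of integral zero. Its
  -- primitive `F` therefore has compact support and is a legitimate test function.
  let χ : ℝ → ℝ := fun x => φ x - m * ρ x
  have hχ : ContDiff ℝ ∞ χ := hφ.sub (contDiff_const.mul hρ)
  have hχc : HasCompactSupport χ := hc.sub (hρc.mul_left (f := fun _ => m))
  have iφ := hφ.continuous.integrable_of_hasCompactSupport (μ := volume) hc
  have iρ := hρ.continuous.integrable_of_hasCompactSupport (μ := volume) hρc
  have iχ := hχ.continuous.integrable_of_hasCompactSupport (μ := volume) hχc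
  have hχ0 : ∫ x, χ x = 0 := by
    change ∫ x, (φ x - m * ρ x) = 0
    rw [integral_sub iφ (iρ.const_mul m), integral_const_mul, hρ1, mul_one, sub_self]
  let F : ℝ → ℝ := fun x => ∫ t in Set.Iic x, χ t
  have hF0 : ∀ x, F x = F 0 + ∫ t in (0 : ℝ)..x, χ t := fun x => by
    rw [intervalIntegral.integral_Iic_sub_Iic iχ.integrableOn iχ.integrableOn |>.symm]
    ring
  have hF : ∀ x, HasDerivAt F (χ x) x := fun x => by
    rw [show F = fun x => F 0 + ∫ t in (0 : ℝ)..x, χ t from funext hF0]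
    exact (intervalIntegral.integral_hasDerivAt_right (hχ.continuous.intervalIntegrable 0 x)
      hχ.continuous.stronglyMeasurable.stronglyMeasurableAtFilter
      hχ.continuous.continuousAt).const_add _
  have hFd : deriv F = χ := funext fun x => (hF x).deriv
  have hFs : ContDiff ℝ ∞ F :=
    contDiff_infty_iff_deriv.2 ⟨fun x => (hF x).differentiableAt, by rwa [hFd]⟩
  have hFc : HasCompactSupport F := by
    obtain ⟨R, hR⟩ := hχc.isCompact.isBounded.subset_closedBall 0
    have z : ∀ y : ℝ, R < |y| → χ y = 0 := fun y hy => by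
      by_contra hne
      have := hR (subset_tsupport χ hne)
      rw [mem_closedBall_zero_iff, Real.norm_eq_abs] at this
      linarith
    refine HasCompactSupport.intro (isCompact_Icc (a := -R) (b := R)) fun x hx => ?_
    rw [Set.mem_Icc, not_and_or, not_le, not_le] at hx
    rcases hx with hx | hx
    · refine setIntegral_eq_zero_of_forall_eq_zero fun t ht => z t ?_
      have : t ≤ x := ht
      exact lt_of_lt_of_le (by linarith) (neg_le_abs t)
    · have h2 : ∫ t in Set.Ioi x, χ t = 0 :=
        setIntegral_eq_zero_of_forall_eq_zero fun t ht => z t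
          ((hx.trans ht).trans_le (le_abs_self t))
      have h3 := intervalIntegral.integral_Iic_add_Ioi (b := x) iχ.integrableOn iχ.integrableOn
      rw [hχ0, h2, add_zero] at h3
      exact h3
  have key := h F hFs hFc
  rw [hFd] at key
  have j1 := hu.integrable_smul_left_of_hasCompactSupport hφ.continuous hc
  have j2 := hu.integrable_smul_left_of_hasCompactSupport hρ.continuous hρc
  have : ∫ x, χ x • u x = (∫ x, φ x • u x) - m • ∫ x, ρ x • u x := by
    have j3 : Integrable (fun x => m • ρ x • u x) volume := j2.smul m
    rw [← integral_smul, ← integral_sub j1 j3]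
    exact integral_congr_ae (.of_forall fun x => by simp only [χ, sub_smul, mul_smul])
  rw [this, sub_eq_zero] at key
  rw [key, integral_smul_const]

/-- Subtracting any primitive of `v` from `u` leaves a vanishing weak derivative, hence a constant.
-/
theorem IsWeakDeriv.exists_isPrimitive {u v : MeasFun} (h : IsWeakDeriv u v) :
    ∃ U : ℝ → ℂ, u =ᵐ[volume] U ∧ IsPrimitive U v := by
  have hp := isPrimitive_intervalIntegral h.2.1 0
  have hpl := hp.continuous.locallyIntegrable (μ := volume)
  obtain ⟨c, hc⟩ := ae_eq_const_of_integral_deriv_smul_eq_zero (h.1.sub hpl) fun φ hφ hφc => by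
    have hd : Continuous (deriv φ) := hφ.continuous_deriv (by simp)
    have j1 := h.1.integrable_smul_left_of_hasCompactSupport hd hφc.deriv
    have j2 := hpl.integrable_smul_left_of_hasCompactSupport hd hφc.deriv
    simp only [Pi.sub_apply, smul_sub]
    rw [integral_sub j1 j2, hp.integral_deriv_smul hφ hφc, h.2.2 φ hφ hφc, sub_self]
  refine ⟨_, ?_, isPrimitive_intervalIntegral h.2.1 c⟩
  filter_upwards [hc] with x hx
  simp only [Pi.sub_apply, zero_add] at hx
  rw [← hx, sub_add_cancel]

theorem IsPrimitive.isWeakDeriv_mk {U f : ℝ → ℂ} (h : IsPrimitive U f)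
    (hU : AEStronglyMeasurable U volume) (hf : AEStronglyMeasurable f volume) :
    IsWeakDeriv (AEEqFun.mk U hU) (AEEqFun.mk f hf) := by
  have e1 := AEEqFun.coeFn_mk U hU
  have e2 := AEEqFun.coeFn_mk f hf
  refine ⟨h.continuous.locallyIntegrable.congr e1.symm, h.locallyIntegrable.congr e2.symm,
    fun φ hφ hc => ?_⟩
  rw [integral_congr_ae (g := fun x => deriv φ x • U x) (e1.mono fun x hx => by simp only [hx]),
    integral_congr_ae (f := fun x => φ x • AEEqFun.mk f hf x) (g := fun x => φ x • f x) (e2.mono fun x hx => by simp only [hx]),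
    h.integral_deriv_smul hφ hc]

/-! ### The equation `U'' = κ² U + b U`. -/

open Filter Topology in
/-- For a solution `U` of `U'' = κ² U + b U` with `0 ≤ Re κ`, the square integrable function
`U' - κ U` vanishes at `-∞` when weighted by `exp (κ x)`, and is controlled by the potential. -/
theorem norm_deriv_sub_mul_le {U V W b : ℝ → ℂ} {κ : ℂ} (hU : IsPrimitive U V)
    (hV : IsPrimitive V W) (hW : W =ᵐ[volume] fun x => κ ^ 2 * U x + b x * U x)
    (hb : Integrable b volume) (hκ : 0 ≤ κ.re) (hP : MemLp (fun x => V x - κ * U x) 2 volume)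
    {M : ℝ} (hM : ∀ x, ‖U x‖ ≤ M) (x : ℝ) :
    ‖V x - κ * U x‖ ≤ M * ∫ t in Set.Iic x, ‖b t‖ := by
  let E : ℝ → ℂ := fun t => Complex.exp (κ * t)
  have hE : ∀ t, HasDerivAt E (κ * E t) t := fun t => by
    have h1 : HasDerivAt (fun t : ℝ => κ * (t : ℂ)) (κ * 1) t :=
      (Complex.ofRealCLM.hasDerivAt (x := t)).const_mul κ
    simpa [E, mul_comm] using h1.cexp
  have hEc : Continuous E := continuous_iff_continuousAt.2 fun t => (hE t).continuousAt
  have hEn : ∀ t, ‖E t‖ = Real.exp (κ.re * t) := fun t => by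
    simp [E, Complex.norm_exp]
  have hEmono : ∀ s t, s ≤ t → ‖E s‖ ≤ ‖E t‖ := fun s t hst => by
    rw [hEn, hEn]
    exact Real.exp_le_exp.2 (mul_le_mul_of_nonneg_left hst hκ)
  -- `E` is the integrating factor of `D + κ`: the `κ` terms cancel and only `b U` survives.
  have hprim : IsPrimitive (fun t => E t * (V t - κ * U t)) (fun t => E t * (b t * U t)) := by
    have h1 := (hV.add (hU.const_mul (-κ))).mul hE (continuous_const.mul hEc)
    have h2 := h1.congr_ae (g := fun t => E t * (b t * U t)) (by
      filter_upwards [hW] with t ht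
      rw [ht]
      ring)
    refine (congrArg (IsPrimitive · _) (funext fun t => ?_)).mpr h2
    ring
  set P : ℝ → ℂ := fun t => V t - κ * U t
  have hbound : ∀ y, ∀ t ∈ Set.Iic y, ‖E t * (b t * U t)‖ ≤ ‖E y‖ * M * ‖b t‖ := by
    intro y t ht
    rw [norm_mul, norm_mul]
    have h1 := hEmono t y ht
    have h2 := hM t
    calc ‖E t‖ * (‖b t‖ * ‖U t‖) ≤ ‖E y‖ * (‖b t‖ * M) := by gcongr
      _ = ‖E y‖ * M * ‖b t‖ := by ring
  have hint : IntegrableOn (fun t => E t * (b t * U t)) (Set.Iic x) volume := by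
    refine Integrable.mono' (hb.norm.const_mul (‖E x‖ * M)).integrableOn ?_
      ((ae_restrict_iff' measurableSet_Iic).2 (.of_forall (hbound x)))
    exact (hEc.aestronglyMeasurable.mul
      (hb.aestronglyMeasurable.mul hU.continuous.aestronglyMeasurable)).restrict
  have hlim : Tendsto (fun y => E y * P y) atBot
      (𝓝 (E x * P x - ∫ t in Set.Iic x, E t * (b t * U t))) := by
    have := (intervalIntegral_tendsto_integral_Iic x hint tendsto_id).const_sub (E x * P x)
    refine this.congr fun y => ?_
    rw [id, ← hprim.sub_eq y x]
    ring
  have hPc : Continuous P := hV.continuous.sub (continuous_const.mul hU.continuous)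
  -- The limit of `E P` at `-∞` must be zero, because `(E P)²` is integrable on a half-line of
  -- infinite measure.
  have hzero : (E x * P x - ∫ t in Set.Iic x, E t * (b t * U t)) ^ 2 = 0 := by
    refine IntegrableAtFilter.eq_zero_of_tendsto (μ := volume) (l := atBot)
      (f := fun y => (E y * P y) ^ 2) ⟨Set.Iic 0, Iic_mem_atBot 0, ?_⟩ ?_ (hlim.pow 2)
    · have hsq : Integrable (fun t => ‖P t‖ ^ 2) volume := by
        simpa using hP.integrable_norm_pow (by simp)
      refine Integrable.mono' hsq.integrableOn
        ((hEc.mul hPc).pow 2).aestronglyMeasurable ?_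
      refine (ae_restrict_iff' measurableSet_Iic).2 (.of_forall fun t ht => ?_)
      have h1 : ‖E t‖ ≤ 1 := by
        have := hEmono t 0 ht
        simpa [hEn] using this
      rw [norm_pow, norm_mul]
      have : ‖E t‖ * ‖P t‖ ≤ ‖P t‖ := mul_le_of_le_one_left (norm_nonneg _) h1
      gcongr
    · intro s hs
      obtain ⟨y, hy⟩ := mem_atBot_sets.1 hs
      exact measure_mono_top (s₁ := Set.Iic y) (fun t ht => hy t ht) Real.volume_Iic
  have heq : E x * P x = ∫ t in Set.Iic x, E t * (b t * U t) :=
    sub_eq_zero.1 (pow_eq_zero_iff two_ne_zero |>.1 hzero)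
  have hle : ‖E x‖ * ‖P x‖ ≤ ‖E x‖ * (M * ∫ t in Set.Iic x, ‖b t‖) := by
    rw [← norm_mul, heq, ← mul_assoc, ← integral_const_mul]
    refine norm_integral_le_of_norm_le (hb.norm.const_mul _).integrableOn ?_
    exact (ae_restrict_iff' measurableSet_Iic).2 (.of_forall (hbound x))
  exact le_of_mul_le_mul_left hle (by rw [hEn]; exact Real.exp_pos _)

/-- `U²` is bounded because its derivative `2 U V` is a product of two `L²` functions, hence
integrable. -/
theorem IsPrimitive.exists_norm_le {U V : ℝ → ℂ} (hU : IsPrimitive U V) (hV : Continuous V)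
    (hU2 : MemLp U 2 volume) (hV2 : MemLp V 2 volume) : ∃ M, ∀ x, ‖U x‖ ≤ M := by
  have hm := hU.mul (hU.hasDerivAt hV) hV
  have hint : Integrable (fun x => V x * U x + U x * V x) volume :=
    (hV2.integrable_mul hU2).add (hU2.integrable_mul hV2)
  set K := ‖U 0 * U 0‖ + ∫ t, ‖V t * U t + U t * V t‖
  have hK0 : 0 ≤ K := add_nonneg (norm_nonneg _) (integral_nonneg fun _ => norm_nonneg _)
  refine ⟨√K, fun x => Real.le_sqrt_of_sq_le ?_⟩
  have h1 : U x * U x = U 0 * U 0 + ∫ t in (0 : ℝ)..x, (V t * U t + U t * V t) := by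
    rw [← hm.sub_eq 0 x]
    ring
  rw [sq, ← norm_mul, h1]
  refine (norm_add_le _ _).trans (add_le_add le_rfl ?_)
  refine intervalIntegral.norm_integral_le_integral_norm_uIoc.trans ?_
  exact setIntegral_le_integral hint.norm (.of_forall fun _ => norm_nonneg _)

/-- The equation `U'' = κ² U + b U` with `0 ≤ Re κ` has no nonzero solution in `H²` as soon as
`‖b‖₁ < 2 |κ|`. -/
theorem eq_zero_of_schrodinger_equation {U V W b : ℝ → ℂ} {κ : ℂ} (hU : IsPrimitive U V)
    (hV : IsPrimitive V W) (hW : W =ᵐ[volume] fun x => κ ^ 2 * U x + b x * U x)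
    (hb : Integrable b volume) (hκ : 0 ≤ κ.re) (hU2 : MemLp U 2 volume) (hV2 : MemLp V 2 volume)
    (hsmall : ∫ t, ‖b t‖ < 2 * ‖κ‖) (x : ℝ) : U x = 0 := by
  have hbdd : BddAbove (Set.range fun x => ‖U x‖) := by
    obtain ⟨M, hM⟩ := hU.exists_norm_le hV.continuous hU2 hV2
    exact ⟨M, by rintro _ ⟨y, rfl⟩; exact hM y⟩
  -- The exact supremum is needed: the final estimate bounds `M` by a multiple of itself with factor
  -- less than one.
  set M := ⨆ x, ‖U x‖
  have hM : ∀ x, ‖U x‖ ≤ M := le_ciSup hbdd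
  have hI0 : 0 ≤ ∫ t, ‖b t‖ := integral_nonneg fun _ => norm_nonneg _
  have hκpos : 0 < ‖κ‖ := by linarith
  have hleft := norm_deriv_sub_mul_le hU hV hW hb hκ (hV2.sub (hU2.const_mul κ)) hM
  have hneg := Measure.measurePreserving_neg (volume : Measure ℝ)
  -- `U (-x)` solves the same equation with potential `b (-x)` and derivative `-V (-x)`, so the
  -- bound on the left half-line applies to it at `-x`.
  have hright : ∀ x, ‖V x + κ * U x‖ ≤ M * ∫ t in Set.Ioi x, ‖b t‖ := by
    intro x
    have hU' := hU.comp_neg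
    have hV' := (hV.comp_neg.const_mul (-1))
    have h2 : IsPrimitive (fun x => -V (-x)) (fun x => W (-x)) := by
      simpa using hV'
    have hW' : (fun x => W (-x)) =ᵐ[volume]
        fun x => κ ^ 2 * U (-x) + b (-x) * U (-x) :=
      hneg.quasiMeasurePreserving.ae_eq_comp hW
    have hP : MemLp (fun x => -V (-x) - κ * U (-x)) 2 volume :=
      (hV2.comp_measurePreserving hneg).neg.sub
        ((hU2.comp_measurePreserving hneg).const_mul κ)
    have := norm_deriv_sub_mul_le hU' h2 hW' hb.comp_neg hκ hP (fun x => hM (-x)) (-x)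
    rw [neg_neg, integral_comp_neg_Iic (-x) (fun t => ‖b t‖), neg_neg] at this
    rwa [← norm_neg, neg_add, ← sub_eq_add_neg]
  have hstep : ∀ x, ‖U x‖ ≤ M * (∫ t, ‖b t‖) / (2 * ‖κ‖) := by
    intro x
    rw [le_div_iff₀ (by positivity)]
    have h3 := intervalIntegral.integral_Iic_add_Ioi (b := x) hb.norm.integrableOn
      hb.norm.integrableOn
    calc ‖U x‖ * (2 * ‖κ‖) = ‖(V x + κ * U x) - (V x - κ * U x)‖ := by
          rw [show (V x + κ * U x) - (V x - κ * U x) = U x * (2 * κ) by ring]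
          simp
      _ ≤ ‖V x + κ * U x‖ + ‖V x - κ * U x‖ := norm_sub_le _ _
      _ ≤ M * (∫ t in Set.Ioi x, ‖b t‖) + M * ∫ t in Set.Iic x, ‖b t‖ :=
          add_le_add (hright x) (hleft x)
      _ = M * ∫ t, ‖b t‖ := by rw [← h3]; ring
  have hM0 : 0 ≤ M := (norm_nonneg _).trans (hM 0)
  have hMle : M ≤ M * (∫ t, ‖b t‖) / (2 * ‖κ‖) := ciSup_le hstep
  rw [le_div_iff₀ (by positivity)] at hMle
  have hMz : M ≤ 0 := by
    by_contra hpos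
    have := mul_lt_mul_of_pos_left hsmall (not_le.1 hpos)
    linarith
  exact norm_le_zero_iff.1 ((hM x).trans hMz)

/-! ### Absence of eigenvalues. -/

theorem pointSpectrum_eq_empty_of_norm_lt {lam μ : ℝ} (hm : 0 < lam + 2 * μ) (a : ℝ →₁[volume] ℂ)
    (ha : ‖a‖ < 2 * √(lam + 2 * μ)) :
    pointSpectrum (dampedElasticWaveOp lam μ (a : MeasFun)) = ∅ := by
  rw [Set.eq_empty_iff_forall_notMem]
  rintro z ⟨⟨⟨u, v⟩, hu, hv⟩, hne, heq⟩
  obtain ⟨h1, h2⟩ := Prod.ext_iff.1 heq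
  change v = z • u at h1
  change lameOp lam μ u - (a : MeasFun) * v = z • v at h2
  suffices hu0 : u = 0 by
    apply hne
    subst hu0
    obtain rfl : v = 0 := h1.trans (smul_zero (A := MeasFun) z)
    rfl
  obtain ⟨hu2, u', u'', d1, d2, hu'2, hu''2⟩ := hu
  rw [lameOp, d1.weakDeriv_eq, d2.weakDeriv_eq] at h2
  set c := √(lam + 2 * μ) with hc
  have hc0 : 0 < c := Real.sqrt_pos.2 hm
  have hcc : (c : ℂ) ^ 2 = lam + 2 * μ := by
    have := Real.sq_sqrt hm.le
    rw [← hc] at this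
    exact_mod_cast congrArg (fun r : ℝ => (r : ℂ)) this
  have hcne : (c : ℂ) ≠ 0 := by exact_mod_cast hc0.ne'
  -- Substituting `v = z u` and dividing by `c² = lam + 2 μ` turns the second row into a Schrödinger
  -- equation.
  have hae : ∀ᵐ x, u'' x = (z / c) ^ 2 * u x + z / (c : ℂ) ^ 2 * (a : ℝ → ℂ) x * u x := by
    have e1 : (μ : ℂ) • u'' + ((lam + μ : ℝ) : ℂ) • u'' = z • v + (a : MeasFun) * v := by
      rw [← h2, sub_add_cancel]
    rw [h1, mul_smul_measFun] at e1
    have e2 : ((c : ℂ) ^ 2) • u'' = z • z • u + z • ((a : MeasFun) * u) := by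
      rw [← e1, hcc, show (lam : ℂ) + 2 * μ = μ + ((lam + μ : ℝ) : ℂ) by push_cast; ring]
      exact add_smul _ _ u''
    have e3 : u'' = ((z / c) ^ 2) • u + (z / (c : ℂ) ^ 2) • ((a : MeasFun) * u) := by
      have := congrArg (fun w => ((c : ℂ) ^ 2)⁻¹ • w) e2
      simp only [smul_add, smul_smul, inv_mul_cancel₀ (pow_ne_zero 2 hcne), one_smul] at this
      rw [this]
      congr 2 <;> field_simp
    have e4 : ⇑u'' =ᵐ[volume]
        ⇑(((z / c) ^ 2) • u + (z / (c : ℂ) ^ 2) • ((a : MeasFun) * u) : MeasFun) := by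
      rw [← e3]
    filter_upwards [e4, AEEqFun.coeFn_add (((z / c) ^ 2) • u)
      ((z / (c : ℂ) ^ 2) • ((a : MeasFun) * u)), AEEqFun.coeFn_smul ((z / c) ^ 2) u,
      AEEqFun.coeFn_smul (z / (c : ℂ) ^ 2) ((a : MeasFun) * u),
      AEEqFun.coeFn_mul (a : MeasFun) u] with x g1 g2 g3 g4 g5
    rw [g1, g2, Pi.add_apply, g3, g4, Pi.smul_apply, Pi.smul_apply, g5, Pi.mul_apply,
      smul_eq_mul, smul_eq_mul, mul_assoc]
  obtain ⟨U, hUu, hU⟩ := d1.exists_isPrimitive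
  obtain ⟨V, hVv, hV⟩ := d2.exists_isPrimitive
  have hU' := hU.congr_ae hVv
  have hU2 := hu2.ae_eq hUu
  have hV2 := hu'2.ae_eq hVv
  suffices h0 : ∀ x, U x = 0 by
    refine AEEqFun.ext ?_
    filter_upwards [hUu, AEEqFun.coeFn_zero (α := ℝ) (β := ℂ) (μ := volume)] with x g1 g2
    rw [g1, g2, h0 x]
    rfl
  have hconst : ∀ {F : ℝ → ℂ}, MemLp F 2 volume → IsPrimitive F (fun _ => 0) → F = fun _ => 0 := by
    intro F hF2 hF
    have hF0 : F = fun _ => F 0 := funext fun x => by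
      have := hF.sub_eq 0 x
      rwa [intervalIntegral.integral_zero, sub_eq_zero] at this
    rw [hF0, memLp_const_iff two_ne_zero ENNReal.ofNat_ne_top] at hF2
    rw [hF0, hF2.resolve_right (by simp)]
  -- For `z = 0` the strict smallness condition degenerates to `0 < 0`. Here `u'' = 0`, so `u'` and
  -- then `u` are constants in `L²(ℝ)`, hence zero.
  by_cases hz : z = 0
  · have hV0 := hconst hV2 (hV.congr_ae (hae.mono fun x hx => by simpa [hz] using hx))
    rw [hV0] at hU'
    exact fun x => congrFun (hconst hU2 hU') x
  have main : ∀ κ : ℂ, κ ^ 2 = (z / c) ^ 2 → 0 ≤ κ.re → ∀ x, U x = 0 := by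
    intro κ hκ hre
    have hκn : ‖κ‖ = ‖z‖ / c := by
      have h3 := congrArg norm hκ
      rw [norm_pow, norm_pow] at h3
      rw [(pow_left_inj₀ (norm_nonneg _) (norm_nonneg _) two_ne_zero).1 h3, norm_div,
        Complex.norm_real, Real.norm_of_nonneg hc0.le]
    refine eq_zero_of_schrodinger_equation (b := fun x => z / (c : ℂ) ^ 2 * (a : ℝ → ℂ) x)
      hU' hV ?_ ((L1.integrable_coeFn a).const_mul _) hre hU2 hV2 ?_
    · filter_upwards [hae, hUu] with x g1 g2
      rw [g1, g2, hκ]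
    · simp only [norm_mul]
      rw [integral_const_mul, ← L1.norm_eq_integral_norm, hκn, norm_div, norm_pow,
        Complex.norm_real, Real.norm_of_nonneg hc0.le]
      have hzp : 0 < ‖z‖ := norm_pos_iff.2 hz
      -- The factor `‖z‖` scales `‖b‖₁` and `2 ‖κ‖` alike, so the threshold on `‖a‖` does not depend
      -- on `z`.
      calc ‖z‖ / c ^ 2 * ‖a‖ < ‖z‖ / c ^ 2 * (2 * c) :=
            mul_lt_mul_of_pos_left ha (by positivity)
        _ = 2 * (‖z‖ / c) := by field_simp
  rcases le_total 0 (z / c).re with h | h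
  · exact main (z / c) rfl h
  · exact main (-(z / c)) (by ring) (by rw [Complex.neg_re]; linarith)

/-! ### Powers of `cosh`: decay, integrals and derivatives. -/

theorem Real.exp_abs_le_two_mul_cosh (x : ℝ) : Real.exp |x| ≤ 2 * Real.cosh x := by
  rw [Real.cosh_eq]
  rcases abs_cases x with ⟨h, -⟩ | ⟨h, -⟩ <;> rw [h] <;>
    linarith [Real.exp_pos x, Real.exp_pos (-x)]

theorem integrable_exp_neg_mul_abs {t : ℝ} (ht : 0 < t) :
    Integrable (fun x : ℝ => Real.exp (-t * |x|)) volume := by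
  rw [← integrableOn_univ, ← Set.Iic_union_Ioi (a := (0 : ℝ))]
  refine IntegrableOn.union ?_ ?_
  · refine (integrableOn_exp_mul_Iic ht 0).congr_fun (fun x hx => ?_) measurableSet_Iic
    simp only [abs_of_nonpos (Set.mem_Iic.1 hx), neg_mul_neg]
  · refine (integrableOn_exp_mul_Ioi (neg_lt_zero.2 ht) 0).congr_fun (fun x hx => ?_)
      measurableSet_Ioi
    simp only [abs_of_pos (Set.mem_Ioi.1 hx)]

theorem Real.continuous_cosh_rpow (t : ℝ) : Continuous fun x => Real.cosh x ^ t :=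
  Real.continuous_cosh.rpow_const fun x => .inl (Real.cosh_pos x).ne'

theorem integrable_cosh_rpow_neg {t : ℝ} (ht : 0 < t) :
    Integrable (fun x => Real.cosh x ^ (-t)) volume := by
  refine ((integrable_exp_neg_mul_abs ht).const_mul ((2 : ℝ) ^ t)).mono'
    (Real.continuous_cosh_rpow _).aestronglyMeasurable (.of_forall fun x => ?_)
  have hc := Real.cosh_pos x
  rw [Real.norm_of_nonneg (Real.rpow_nonneg hc.le _)]
  calc Real.cosh x ^ (-t) = 2 ^ t * (2 * Real.cosh x) ^ (-t) := by
        rw [Real.mul_rpow two_pos.le hc.le, ← mul_assoc, ← Real.rpow_add two_pos, add_neg_cancel,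
          Real.rpow_zero, one_mul]
    _ ≤ 2 ^ t * Real.exp |x| ^ (-t) := by
        gcongr 2 ^ t * ?_
        exact Real.rpow_le_rpow_of_nonpos (Real.exp_pos _) (Real.exp_abs_le_two_mul_cosh x)
          (neg_nonpos.2 ht.le)
    _ = 2 ^ t * Real.exp (-t * |x|) := by rw [← Real.exp_mul, mul_comm |x|]

theorem Real.hasDerivAt_sinh_div_cosh (x : ℝ) :
    HasDerivAt (fun x => Real.sinh x / Real.cosh x) (Real.cosh x ^ (-2 : ℝ)) x := by
  have hc := Real.cosh_pos x
  convert! (Real.hasDerivAt_sinh x).div (Real.hasDerivAt_cosh x) hc.ne' using 1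
  rw [Real.rpow_neg hc.le, Real.rpow_two, inv_eq_one_div]
  congr 1
  nlinarith [Real.cosh_sq x]

theorem Real.abs_sinh_div_cosh_le (x : ℝ) : |Real.sinh x / Real.cosh x| ≤ 1 := by
  have hc := Real.cosh_pos x
  rw [abs_div, abs_of_pos hc, div_le_one hc]
  exact abs_le_of_sq_le_sq (by rw [Real.cosh_sq]; linarith) hc.le

open Filter Topology in
theorem Real.tendsto_sinh_div_cosh_atTop :
    Tendsto (fun x => Real.sinh x / Real.cosh x) atTop (𝓝 1) := by
  have h : Tendsto (fun x : ℝ => Real.exp (-2 * x)) atTop (𝓝 0) :=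
    Real.tendsto_exp_atBot.comp (tendsto_id.const_mul_atTop_of_neg (by norm_num))
  have h2 : Tendsto (fun x : ℝ => (1 - Real.exp (-2 * x)) / (1 + Real.exp (-2 * x))) atTop
      (𝓝 ((1 - 0) / (1 + 0))) := (h.const_sub 1).div (h.const_add 1) (by norm_num)
  rw [sub_zero, add_zero, div_one] at h2
  refine h2.congr fun x => ?_
  have e : Real.exp (-x) = Real.exp x * Real.exp (-2 * x) := by
    rw [← Real.exp_add]
    congr 1
    ring
  rw [Real.sinh_eq, Real.cosh_eq, e, div_div_div_cancel_right₀ two_ne_zero,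
    ← mul_one_sub, ← mul_one_add, mul_div_mul_left _ _ (Real.exp_pos x).ne']

-- `sech²` is the derivative of `tanh`, which runs from `-1` to `1`.
open Filter Topology in
theorem integral_cosh_rpow_neg_two : ∫ x : ℝ, Real.cosh x ^ (-2 : ℝ) = 2 := by
  have hbot : Tendsto (fun x => Real.sinh x / Real.cosh x) atBot (𝓝 (-1)) := by
    refine (Real.tendsto_sinh_div_cosh_atTop.comp tendsto_neg_atBot_atTop).neg.congr fun x => ?_
    simp [neg_div]
  rw [integral_of_hasDerivAt_of_tendsto Real.hasDerivAt_sinh_div_cosh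
    (integrable_cosh_rpow_neg two_pos) hbot Real.tendsto_sinh_div_cosh_atTop]
  norm_num

theorem memLp_two_cosh_rpow_neg {s : ℝ} (hs : 0 < s) :
    MemLp (fun x => ((Real.cosh x ^ (-s) : ℝ) : ℂ)) 2 volume := by
  have hc : Continuous fun x => ((Real.cosh x ^ (-s) : ℝ) : ℂ) :=
    Complex.continuous_ofReal.comp (Real.continuous_cosh_rpow _)
  rw [memLp_two_iff_integrable_sq_norm hc.aestronglyMeasurable]
  refine (integrable_cosh_rpow_neg (t := 2 * s) (by positivity)).congr (.of_forall fun x => ?_)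
  simp only
  rw [Complex.norm_real, Real.norm_eq_abs, sq_abs, ← Real.rpow_mul_natCast (Real.cosh_pos x).le]
  congr 1
  push_cast
  ring

/-- `cosh ^ (-s)` is square integrable together with its products with bounded continuous
functions. -/
theorem memLp_two_mul_cosh_rpow_neg {s : ℝ} (hs : 0 < s) {g : ℝ → ℝ} (hg : Continuous g) {K : ℝ}
    (hK : ∀ x, |g x| ≤ K) :
    MemLp (fun x => ((g x * Real.cosh x ^ (-s) : ℝ) : ℂ)) 2 volume := by
  refine (memLp_two_cosh_rpow_neg hs).of_le_mul (c := K) ?_ (.of_forall fun x => ?_)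
  · exact (Complex.continuous_ofReal.comp
      (hg.mul (Real.continuous_cosh_rpow _))).aestronglyMeasurable
  · simp only [Complex.norm_real, norm_mul, Real.norm_eq_abs]
    gcongr
    exact hK x

theorem hasDerivAt_cosh_rpow_neg (s x : ℝ) :
    HasDerivAt (fun x => Real.cosh x ^ (-s))
      (-s * (Real.sinh x / Real.cosh x) * Real.cosh x ^ (-s)) x := by
  have hc := Real.cosh_pos x
  convert! (Real.hasDerivAt_cosh x).rpow_const (p := -s) (.inl hc.ne') using 1
  rw [Real.rpow_sub_one hc.ne']
  field_simp

theorem hasDerivAt_deriv_cosh_rpow_neg (s x : ℝ) :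
    HasDerivAt (fun x => -s * (Real.sinh x / Real.cosh x) * Real.cosh x ^ (-s))
      ((s ^ 2 - s * (s + 1) * Real.cosh x ^ (-2 : ℝ)) * Real.cosh x ^ (-s)) x := by
  have hc := Real.cosh_pos x
  convert! ((Real.hasDerivAt_sinh_div_cosh x).const_mul (-s)).mul (hasDerivAt_cosh_rpow_neg s x)
    using 1
  -- `tanh² = 1 - sech²` removes the `tanh²` produced by differentiating `cosh^{-s}` twice.
  have h : (Real.sinh x / Real.cosh x) ^ 2 = 1 - Real.cosh x ^ (-2 : ℝ) := by
    rw [Real.rpow_neg hc.le, Real.rpow_two, div_pow, Real.sinh_sq]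
    field_simp
  linear_combination (-s ^ 2 * Real.cosh x ^ (-s)) * h

/-! ### Dampings with an eigenvalue, and the optimal constant. -/

/-- The function `cosh ^ (-s)` is an eigenfunction, with eigenvalue `s √(lam + 2 μ)`, for the
damping `-(s + 1) √(lam + 2 μ) cosh ^ (-2)`. -/
theorem exists_damping_pointSpectrum_nonempty {lam μ s : ℝ} (hm : 0 < lam + 2 * μ) (hs : 0 < s) :
    ∃ a : ℝ →₁[volume] ℂ, MemLp a ⊤ volume ∧ ‖a‖ = 2 * √(lam + 2 * μ) * (1 + s) ∧
      (pointSpectrum (dampedElasticWaveOp lam μ (a : MeasFun))).Nonempty := by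
  set c := √(lam + 2 * μ) with hc
  have hc0 : 0 < c := Real.sqrt_pos.2 hm
  have hcc : c ^ 2 = lam + 2 * μ := Real.sq_sqrt hm.le
  have hsech : ∀ x, Real.cosh x ^ (-2 : ℝ) ≤ 1 := fun x =>
    Real.rpow_le_one_of_one_le_of_nonpos (Real.one_le_cosh x) (by norm_num)
  have hsech0 : ∀ x, 0 ≤ Real.cosh x ^ (-2 : ℝ) := fun x => Real.rpow_nonneg (Real.cosh_pos x).le _
  let α : ℝ → ℂ := fun x => ((-(c * (s + 1)) * Real.cosh x ^ (-2 : ℝ) : ℝ) : ℂ)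
  have hα : Integrable α volume := ((integrable_cosh_rpow_neg two_pos).const_mul _).ofReal
  have hαn : ∀ x, ‖α x‖ = c * (s + 1) * Real.cosh x ^ (-2 : ℝ) := fun x => by
    simp only [α]
    rw [Complex.norm_real, norm_mul, norm_neg, Real.norm_of_nonneg (by positivity),
      Real.norm_of_nonneg (hsech0 x)]
  refine ⟨hα.toL1 α, ?_, ?_, ((c * s : ℝ) : ℂ), ?_⟩
  · refine (memLp_top_of_bound hα.aestronglyMeasurable (c * (s + 1))
      (.of_forall fun x => ?_)).ae_eq hα.coeFn_toL1.symm
    rw [hαn]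
    exact mul_le_of_le_one_right (by positivity) (hsech x)
  · rw [L1.norm_eq_integral_norm, integral_congr_ae (g := fun x => c * (s + 1) * Real.cosh x ^ (-2 : ℝ))
      (hα.coeFn_toL1.mono fun x hx => by simp only [hx, hαn]),
      integral_const_mul, integral_cosh_rpow_neg_two]
    ring
  have htc : Continuous fun x => Real.sinh x / Real.cosh x :=
    Real.continuous_sinh.div Real.continuous_cosh fun x => (Real.cosh_pos x).ne'
  let U : ℝ → ℂ := fun x => ((Real.cosh x ^ (-s) : ℝ) : ℂ)
  let V : ℝ → ℂ := fun x => ((-s * (Real.sinh x / Real.cosh x) * Real.cosh x ^ (-s) : ℝ) : ℂ)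
  let W : ℝ → ℂ := fun x =>
    (((s ^ 2 - s * (s + 1) * Real.cosh x ^ (-2 : ℝ)) * Real.cosh x ^ (-s) : ℝ) : ℂ)
  have hUc : Continuous U := Complex.continuous_ofReal.comp (Real.continuous_cosh_rpow _)
  have hVr : Continuous fun x => -s * (Real.sinh x / Real.cosh x) := continuous_const.mul htc
  have hVc : Continuous V :=
    Complex.continuous_ofReal.comp (hVr.mul (Real.continuous_cosh_rpow _))
  have hWr : Continuous fun x => s ^ 2 - s * (s + 1) * Real.cosh x ^ (-2 : ℝ) :=
    continuous_const.sub (continuous_const.mul (Real.continuous_cosh_rpow _))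
  have hWc : Continuous W :=
    Complex.continuous_ofReal.comp (hWr.mul (Real.continuous_cosh_rpow _))
  have hU2 : MemLp U 2 volume := memLp_two_cosh_rpow_neg hs
  have hV2 : MemLp V 2 volume := memLp_two_mul_cosh_rpow_neg hs hVr (K := s) fun x => by
    rw [abs_mul, abs_neg, abs_of_pos hs]
    exact mul_le_of_le_one_right hs.le (Real.abs_sinh_div_cosh_le x)
  have hW2 : MemLp W 2 volume :=
    memLp_two_mul_cosh_rpow_neg hs hWr (K := s ^ 2 + s * (s + 1)) fun x => by
      refine (abs_sub _ _).trans (add_le_add (abs_of_nonneg (sq_nonneg s)).le ?_)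
      rw [abs_of_nonneg (mul_nonneg (by positivity) (hsech0 x))]
      exact mul_le_of_le_one_right (by positivity) (hsech x)
  have d1 := (IsPrimitive.of_hasDerivAt (U := U) (f := V)
    (fun x => (hasDerivAt_cosh_rpow_neg s x).ofReal_comp) hVc).isWeakDeriv_mk
      hUc.aestronglyMeasurable hVc.aestronglyMeasurable
  have d2 := (IsPrimitive.of_hasDerivAt (U := V) (f := W)
    (fun x => (hasDerivAt_deriv_cosh_rpow_neg s x).ofReal_comp) hWc).isWeakDeriv_mk
      hVc.aestronglyMeasurable hWc.aestronglyMeasurable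
  set u : MeasFun := AEEqFun.mk U hUc.aestronglyMeasurable
  set v : MeasFun := AEEqFun.mk V hVc.aestronglyMeasurable
  set w : MeasFun := AEEqFun.mk W hWc.aestronglyMeasurable
  have eu : u =ᵐ[volume] U := AEEqFun.coeFn_mk _ _
  have ev : v =ᵐ[volume] V := AEEqFun.coeFn_mk _ _
  have ew : w =ᵐ[volume] W := AEEqFun.coeFn_mk _ _
  have mu : u ∈ sobolevH2 := ⟨hU2.ae_eq eu.symm, v, w, d1, d2, hV2.ae_eq ev.symm,
    hW2.ae_eq ew.symm⟩
  have mu' : u ∈ homSobolevH1 := ⟨v, d1, hV2.ae_eq ev.symm⟩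
  refine ⟨⟨(u, ((c * s : ℝ) : ℂ) • u), mu, homSobolevH1.smul_mem _ mu'⟩, fun h0 => ?_, ?_⟩
  -- For continuous functions equality almost everywhere is equality, and `U 0 = 1`.
  · have h1 : u = 0 := congrArg (fun Ψ => Ψ.1.1) h0
    rw [h1] at eu
    have h2 : U =ᵐ[volume] fun _ => 0 := eu.symm.trans AEEqFun.coeFn_zero
    have h3 := congrFun ((hUc.ae_eq_iff_eq volume continuous_const).1 h2) 0
    simp [U] at h3
  · refine Prod.ext rfl ?_
    change lameOp lam μ u - (hα.toL1 α : MeasFun) * (((c * s : ℝ) : ℂ) • u)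
      = ((c * s : ℝ) : ℂ) • ((c * s : ℝ) : ℂ) • u
    rw [lameOp, d1.weakDeriv_eq, d2.weakDeriv_eq, mul_smul_measFun, sub_eq_iff_eq_add]
    refine AEEqFun.ext ?_
    filter_upwards [eu, ew, hα.coeFn_toL1,
      AEEqFun.coeFn_add ((μ : ℂ) • w) (((lam + μ : ℝ) : ℂ) • w),
      AEEqFun.coeFn_smul (μ : ℂ) w, AEEqFun.coeFn_smul ((lam + μ : ℝ) : ℂ) w,
      AEEqFun.coeFn_add (((c * s : ℝ) : ℂ) • ((c * s : ℝ) : ℂ) • u)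
        (((c * s : ℝ) : ℂ) • ((hα.toL1 α : MeasFun) * u)),
      AEEqFun.coeFn_smul ((c * s : ℝ) : ℂ) (((c * s : ℝ) : ℂ) • u),
      AEEqFun.coeFn_smul ((c * s : ℝ) : ℂ) u,
      AEEqFun.coeFn_smul ((c * s : ℝ) : ℂ) ((hα.toL1 α : MeasFun) * u),
      AEEqFun.coeFn_mul (hα.toL1 α : MeasFun) u] with x g1 g2 g3 g4 g5 g6 g7 g8 g9 g10 g11
    rw [g4, Pi.add_apply, g5, g6, g7, Pi.add_apply, g8, Pi.smul_apply, Pi.smul_apply,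
      Pi.smul_apply, g9, Pi.smul_apply, g10, Pi.smul_apply, g11, Pi.mul_apply, g1, g2, g3]
    simp only [smul_eq_mul, U, W, α]
    generalize Real.cosh x ^ (-2 : ℝ) = p
    generalize Real.cosh x ^ (-s) = q
    norm_cast
    linear_combination (-(s ^ 2 - s * (s + 1) * p) * q) * hcc

theorem theorem1p9 (lam μ : ℝ) (hμ : 0 < μ) (hlam : 0 ≤ lam + μ) :
    (∀ a : ℝ →₁[volume] ℂ, ‖a‖ < 2 * √(lam + 2 * μ) →
      pointSpectrum (dampedElasticWaveOp lam μ (a : MeasFun)) = ∅) ∧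
    (∀ C : ℝ, 2 * √(lam + 2 * μ) < C →
      ∃ a : ℝ →₁[volume] ℂ, MemLp a ⊤ volume ∧ ‖a‖ < C ∧
        (pointSpectrum (dampedElasticWaveOp lam μ (a : MeasFun))).Nonempty) := by
  have hm : 0 < lam + 2 * μ := by linarith
  refine ⟨fun a ha => pointSpectrum_eq_empty_of_norm_lt hm a ha, fun C hC => ?_⟩
  have hk : 0 < 2 * √(lam + 2 * μ) := mul_pos two_pos (Real.sqrt_pos.2 hm)
  set k := 2 * √(lam + 2 * μ) with hkdef
  -- The choice `0 < s < (C - k) / k` is what makes the norm `k (1 + s)` smaller than `C`.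
  obtain ⟨s, hs0, hs⟩ := exists_between (div_pos (sub_pos.2 hC) hk)
  obtain ⟨a, ha, hn, hσ⟩ := exists_damping_pointSpectrum_nonempty (lam := lam) (μ := μ) hm hs0
  refine ⟨a, ha, ?_, hσ⟩
  rw [lt_div_iff₀ hk] at hs
  rw [hn, ← hkdef]
  linarith
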